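/- For an integer $N\ge 1$ and a real $W\in(0,1/2)$, let $\widetilde\lambda_{0,N}(W)\ge\widetilde\lambda_{1,N}(W)\ge\cdots\ge\widetilde\lambda_{N-1,N}(W)$ be the $N$ largest eigenvalues, listed in decreasing order with multiplicity, of the positive self-adjoint finite rank operator $\widetilde Q_{W,N}$ on $L^2(-W,W)$, $$\widetilde Q_{W,N}f(x)=\int_{-W}^{W}\frac{\sin(N\pi(x-y))}{\sin(\pi(x-y))}\,f(y)\,dy$$ (its eigenfunctions for these eigenvalues are the discrete prolate spheroidal wave functions). For $c>0$, let $\lambda_0(c)\ge\lambda_1(c)\ge\cdots$ be the eigenvalues, listed in decreasing order with multiplicity, of the positive self-adjoint compact operator $\mathcal Q_c$ on $L^2(-1,1)$, $$\mathcal Q_c f(x)=\int_{-1}^{1}\frac{\sin(c(x-y))}{\pi(x-y)}\,f(y)\,dy .$$ Theorem. For every integer $N\ge 1$ and every real $W\in(0,1/2)$, with $c=\pi N W$, $$\widetilde\lambda_{n,N}(W)\le A_W\,\lambda_n(c),\qquad 0\le n\le N-1,$$ where $$A_W=\frac{2\pi^2}{\cos^2(\pi W)}\Big(\frac14-W^2\Big)^2\qquad\text{and}\qquad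 \frac{\pi^2}{8}\le A_W\le 2 .$$ -/

import Mathlib

noncomputable section

open MeasureTheory

/-- The complex Hilbert space `L²(-a, a)` (Lebesgue measure on the interval). -/
abbrev L2Interval (a : ℝ) : Type :=
  Lp ℂ 2 (volume.restrict (Set.Icc (-a) a))

/-- `x ↦ ∫_{-a}^{a} k(x - y) f(y) dy`. -/
def convIntegral (a : ℝ) (k : ℝ → ℝ) (f : ℝ → ℂ) (x : ℝ) : ℂ :=
  ∫ y in Set.Icc (-a) a, (k (x - y) : ℂ) * f y

theorem convIntegral_integrable {a C : ℝ} {k : ℝ → ℝ} (hk : Measurable k)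
    (hb : ∀ t, |k t| ≤ C) (f : L2Interval a) (x : ℝ) :
    Integrable (fun y => (k (x - y) : ℂ) * f y) (volume.restrict (Set.Icc (-a) a)) := by
  have hf : Integrable (f : ℝ → ℂ) (volume.restrict (Set.Icc (-a) a)) :=
    (Lp.memLp f).integrable (by norm_num)
  refine hf.bdd_mul (c := C) ?_ ?_
  · exact (Complex.measurable_ofReal.comp
      (hk.comp (measurable_const.sub measurable_id))).aestronglyMeasurable
  · exact Filter.Eventually.of_forall fun y => by simpa using hb (x - y)

theorem convIntegral_memLp {a C : ℝ} {k : ℝ → ℝ} (hk : Measurable k)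
    (hb : ∀ t, |k t| ≤ C) (f : L2Interval a) :
    MemLp (convIntegral a k f) 2 (volume.restrict (Set.Icc (-a) a)) := by
  have hf : Integrable (f : ℝ → ℂ) (volume.restrict (Set.Icc (-a) a)) :=
    (Lp.memLp f).integrable (by norm_num)
  refine MemLp.of_bound ?_ (∫ y in Set.Icc (-a) a, C * ‖f y‖) ?_
  · have h : AEStronglyMeasurable
        (fun p : ℝ × ℝ => (k (p.1 - p.2) : ℂ) * f p.2)
        ((volume.restrict (Set.Icc (-a) a)).prod (volume.restrict (Set.Icc (-a) a))) := by
      refine AEStronglyMeasurable.mul ?_ ?_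
      · exact (Complex.measurable_ofReal.comp
          (hk.comp (measurable_fst.sub measurable_snd))).aestronglyMeasurable
      · exact (Lp.aestronglyMeasurable f).comp_snd
    exact h.integral_prod_right'
  · refine Filter.Eventually.of_forall fun x => ?_
    refine norm_integral_le_of_norm_le (hf.norm.const_mul C) ?_
    refine Filter.Eventually.of_forall fun y => ?_
    rw [norm_mul]
    exact mul_le_mul_of_nonneg_right (by simpa using hb (x - y)) (norm_nonneg _)

/-- The integral operator `(T f)(x) = ∫_{-a}^{a} k(x - y) f(y) dy` on `L²(-a, a)`, for a bounded
measurable function `k`. -/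
def convOperator (a : ℝ) (k : ℝ → ℝ) {C : ℝ} (hk : Measurable k) (hb : ∀ t, |k t| ≤ C) :
    Module.End ℂ (L2Interval a) where
  toFun f := (convIntegral_memLp hk hb f).toLp (convIntegral a k f)
  map_add' f g := by
    rw [← MemLp.toLp_add]
    congr 1
    funext x
    simp only [convIntegral, Pi.add_apply]
    rw [← integral_add (convIntegral_integrable hk hb f x) (convIntegral_integrable hk hb g x)]
    refine integral_congr_ae ?_
    filter_upwards [Lp.coeFn_add f g] with y hy
    rw [hy, Pi.add_apply, mul_add]
  map_smul' r f := by
    rw [RingHom.id_apply, ← MemLp.toLp_const_smul]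
    congr 1
    funext x
    simp only [convIntegral, Pi.smul_apply]
    rw [← integral_smul]
    refine integral_congr_ae ?_
    filter_upwards [Lp.coeFn_smul r f] with y hy
    rw [hy, Pi.smul_apply, smul_eq_mul, smul_eq_mul, mul_left_comm]

/-- The `n`-th (`n = 0, 1, 2, …`) eigenvalue of `T`, when its real eigenvalues are listed in
decreasing order and repeated according to their (geometric) multiplicities: the largest `μ` such
that the eigenvectors of `T` with eigenvalue at least `μ` span a space of dimension at least
`n + 1`. -/
def nthEigenvalue {H : Type*} [AddCommGroup H] [Module ℂ H] (T : Module.End ℂ H) (n : ℕ) : ℝ :=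
  sSup {μ : ℝ | ((n + 1 : ℕ) : Cardinal) ≤
    Module.rank ℂ (⨆ ν : ℝ, ⨆ _ : μ ≤ ν, T.eigenspace (ν : ℂ) : Submodule ℂ H)}

/-- The sinc kernel `sin(c t) / (π t)`. (Its value at the single point `t = 0` is irrelevant, since
it is only used under an integral.) -/
def sincKernel (c t : ℝ) : ℝ := Real.sin (c * t) / (Real.pi * t)

/-- The Dirichlet kernel `sin(N π t) / sin(π t)`. (Its values at the integers are irrelevant, since
it is only used under an integral.) -/
def dirichletKernel (N : ℕ) (t : ℝ) : ℝ := Real.sin (N * Real.pi * t) / Real.sin (Real.pi * t)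

theorem sincKernel_measurable (c : ℝ) : Measurable (sincKernel c) := by
  unfold sincKernel; fun_prop

theorem dirichletKernel_measurable (N : ℕ) : Measurable (dirichletKernel N) := by
  unfold dirichletKernel; fun_prop

theorem sincKernel_abs_le (c t : ℝ) : |sincKernel c t| ≤ |c| / Real.pi := by
  unfold sincKernel
  rcases eq_or_ne t 0 with rfl | ht
  · simp only [mul_zero, div_zero, abs_zero]
    positivity
  · rw [abs_div, abs_mul Real.pi, abs_of_pos Real.pi_pos,
      div_le_div_iff₀ (by positivity) Real.pi_pos]
    have h : |Real.sin (c * t)| ≤ |c| * |t| := by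
      rw [← abs_mul]; exact Real.abs_sin_le_abs
    nlinarith [Real.pi_pos]

theorem abs_sin_nat_mul_le (N : ℕ) (u : ℝ) : |Real.sin (N * u)| ≤ N * |Real.sin u| := by
  induction N with
  | zero => simp
  | succ k ih =>
    push_cast
    rw [add_mul, one_mul, Real.sin_add]
    calc |Real.sin (k * u) * Real.cos u + Real.cos (k * u) * Real.sin u|
        ≤ |Real.sin (k * u)| * |Real.cos u| + |Real.cos (k * u)| * |Real.sin u| := by
          rw [← abs_mul, ← abs_mul]; exact abs_add_le _ _
      _ ≤ |Real.sin (k * u)| * 1 + 1 * |Real.sin u| := by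
          gcongr
          · exact Real.abs_cos_le_one _
          · exact Real.abs_cos_le_one _
      _ ≤ (k + 1) * |Real.sin u| := by linarith

theorem dirichletKernel_abs_le (N : ℕ) (t : ℝ) : |dirichletKernel N t| ≤ N := by
  unfold dirichletKernel
  rw [mul_assoc, abs_div]
  exact div_le_of_le_mul₀ (abs_nonneg _) (Nat.cast_nonneg N) (abs_sin_nat_mul_le N _)

/-- The sinc-kernel operator `Q_c f(x) = ∫_{-1}^{1} sin(c(x-y)) / (π(x-y)) f(y) dy` on
`L²(-1, 1)`. -/
def sincOperator (c : ℝ) : Module.End ℂ (L2Interval 1) :=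
  convOperator 1 (sincKernel c) (sincKernel_measurable c) (sincKernel_abs_le c)

/-- The operator `f ↦ ∫_{-W}^{W} sin(Nπ(x-y)) / sin(π(x-y)) f(y) dy` on `L²(-W, W)`, whose
eigenfunctions for nonzero eigenvalues are the discrete prolate spheroidal wave functions. -/
def dpswfOperator (N : ℕ) (W : ℝ) : Module.End ℂ (L2Interval W) :=
  convOperator W (dirichletKernel N) (dirichletKernel_measurable N) (dirichletKernel_abs_le N)

/-- `λ_n(c)`, the `n`-th eigenvalue of the sinc-kernel operator. -/
def sincEigenvalue (c : ℝ) (n : ℕ) : ℝ := nthEigenvalue (sincOperator c) n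

/-- `λ̃_{n,N}(W)`, the eigenvalue of the `n`-th discrete prolate spheroidal wave function. -/
def dpswfEigenvalue (N : ℕ) (W : ℝ) (n : ℕ) : ℝ := nthEigenvalue (dpswfOperator N W) n

/-- The constant `A_W`. -/
def comparisonConst (W : ℝ) : ℝ :=
  2 * Real.pi ^ 2 / Real.cos (Real.pi * W) ^ 2 * (1 / 4 - W ^ 2) ^ 2

end

/-!
For a kernel that is a superposition of exponentials, `k t = w * ∫ s, exp (i θ(s) t) ∂ν`, the
form of the convolution operator is `w * ∫ s, |f̂(θ s)|² ∂ν` (`inner_convOperator`). Thus the form of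
the Dirichlet operator at `f` is the sum of `|f̂|²` over the `N` unit-spaced frequencies
`s_j = j - (N - 1) / 2`, while that of the sinc operator, carried from `(-1, 1)` to `(-W, W)`, is the
integral of `|f̂|²` over the frequency band `(-N / 2, N / 2)`, which the unit intervals around the
`s_j` tile.

Samples are dominated by averages as follows. Let `ψ` be the Fourier transform of the window
`cos (π u)` on `(-1/2, 1/2)`, and write `f = ψ g`. Then `f̂(s)` is the average of `ĝ(s + u)` against
this window, and the Cauchy-Schwarz inequality gives
`|f̂(s)|² ≤ (1/2) ∫_{s-1/2}^{s+1/2} |ĝ|²`. Summing over `j` bounds the Dirichlet form at `f` by half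
the sinc form at `g = f / ψ` (`sum_sq_norm_windowFourier_le`). As `ψ` is even and decreasing on
`(0, 1/2)`, the norms satisfy `‖g‖ ≤ ‖f‖ / ψ(W)`. The explicit value of `ψ` gives
`A_W = 1 / (2 ψ(W)²)`, and `1/2 = ψ(1/2) ≤ ψ(W) ≤ ψ(0) = 2 / π` gives the bounds on `A_W`.

The passage from forms to eigenvalues is the min-max principle (`nthEigenvalue_le_of_forall`): a
space of dimension `n + 1` on which the sinc form is at least `μ` must meet the orthogonal
complement of the eigenvectors with eigenvalue at least `ξ < μ` if these span at most `n`
dimensions, but there the form is at most `ξ`. The last fact is the spectral theorem for the sinc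
operator, whose compactness comes from polynomial approximation of its kernel
(`isCompactOperator_convOperator`).
-/

open MeasureTheory

/-! ### Comparison of eigenvalues by quadratic forms -/

section Comparison

variable {H : Type*} [NormedAddCommGroup H] [InnerProductSpace ℂ H]

/-- A vector in the span of the eigenspaces with eigenvalue in `S` is an orthogonal sum of
eigenvectors, along which the norm and the quadratic form of `T` split. -/
theorem exists_eigenvector_decomposition {T : Module.End ℂ H} (hT : T.IsSymmetric) {S : Set ℝ}
    {x : H} (hx : x ∈ (⨆ ν : ℝ, ⨆ _ : ν ∈ S, T.eigenspace (ν : ℂ) : Submodule ℂ H)) :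
    ∃ f : ℝ →₀ H, (∀ ν ∈ f.support, ν ∈ S) ∧ ‖x‖ ^ 2 = ∑ ν ∈ f.support, ‖f ν‖ ^ 2 ∧
      (inner ℂ x (T x)).re = ∑ ν ∈ f.support, ν * ‖f ν‖ ^ 2 := by
  obtain ⟨f, hf, rfl⟩ := (Submodule.mem_iSup_iff_exists_finsupp _ _).1 hx
  have hS : ∀ ν ∈ f.support, ν ∈ S := by
    intro ν hν
    by_contra hνS
    have h0 := hf ν
    simp only [hνS, iSup_false, Submodule.mem_bot] at h0
    exact Finsupp.mem_support_iff.1 hν h0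
  have heig : ∀ ν : ℝ, f ν ∈ T.eigenspace (ν : ℂ) := fun ν =>
    (iSup_le fun _ => le_rfl : (⨆ _ : ν ∈ S, T.eigenspace (ν : ℂ)) ≤ T.eigenspace (ν : ℂ)) (hf ν)
  have horth : ∀ ν ξ : ℝ, ν ≠ ξ → inner ℂ (f ν) (f ξ) = 0 := fun ν ξ hne =>
    hT.orthogonalFamily_eigenspaces (fun h => hne (Complex.ofReal_injective h))
      ⟨f ν, heig ν⟩ ⟨f ξ, heig ξ⟩
  refine ⟨f, hS, ?_, ?_⟩
  · rw [← inner_self_eq_norm_sq (𝕜 := ℂ), Finsupp.sum, sum_inner, map_sum]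
    refine Finset.sum_congr rfl fun ν hν => ?_
    rw [inner_sum, Finset.sum_eq_single ν (fun ξ _ hne => horth ν ξ hne.symm)
      (fun h => absurd hν h), inner_self_eq_norm_sq]
  · rw [Finsupp.sum, map_sum, sum_inner, Complex.re_sum]
    refine Finset.sum_congr rfl fun ν hν => ?_
    have h1 : ∀ ξ : ℝ, T (f ξ) = (ξ : ℂ) • f ξ := fun ξ => Module.End.mem_eigenspace_iff.1 (heig ξ)
    simp only [h1]
    rw [inner_sum, Finset.sum_eq_single ν
      (fun ξ _ hne => by rw [inner_smul_right, horth ν ξ hne.symm, mul_zero])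
      (fun h => absurd hν h), inner_smul_right, inner_self_eq_norm_sq_to_K,
      ← RCLike.ofReal_pow]
    exact Complex.re_ofReal_mul _ _

theorem mul_norm_sq_le_re_inner {T : Module.End ℂ H} (hT : T.IsSymmetric) {μ : ℝ} {x : H}
    (hx : x ∈ (⨆ ν : ℝ, ⨆ _ : μ ≤ ν, T.eigenspace (ν : ℂ) : Submodule ℂ H)) :
    μ * ‖x‖ ^ 2 ≤ (inner ℂ x (T x)).re := by
  obtain ⟨f, hf, h1, h2⟩ := exists_eigenvector_decomposition (S := Set.Ici μ) hT hx
  rw [h1, h2, Finset.mul_sum]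
  exact Finset.sum_le_sum fun ν hν => mul_le_mul_of_nonneg_right (hf ν hν) (sq_nonneg _)

theorem re_inner_le_mul_norm_sq {T : Module.End ℂ H} (hT : T.IsSymmetric) {μ : ℝ} {x : H}
    (hx : x ∈ (⨆ ν : ℝ, ⨆ _ : ν < μ, T.eigenspace (ν : ℂ) : Submodule ℂ H)) :
    (inner ℂ x (T x)).re ≤ μ * ‖x‖ ^ 2 := by
  obtain ⟨f, hf, h1, h2⟩ := exists_eigenvector_decomposition (S := Set.Iio μ) hT hx
  rw [h1, h2, Finset.mul_sum]
  exact Finset.sum_le_sum fun ν hν => mul_le_mul_of_nonneg_right (hf ν hν).le (sq_nonneg _)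

/-- On the orthogonal complement of the eigenvectors with eigenvalue at least `μ`, the quadratic
form of a compact symmetric operator is at most `μ`: by the spectral theorem this complement lies
in the closed span of the eigenvectors with eigenvalue less than `μ`. -/
theorem re_inner_le_of_mem_orthogonal [CompleteSpace H] {T : Module.End ℂ H}
    (hc : IsCompactOperator T) (hT : T.IsSymmetric) {μ : ℝ} {x : H}
    (hx : x ∈ (⨆ ν : ℝ, ⨆ _ : μ ≤ ν, T.eigenspace (ν : ℂ) :
      Submodule ℂ H)ᗮ) :
    (inner ℂ x (T x)).re ≤ μ * ‖x‖ ^ 2 := by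
  set E : Submodule ℂ H := ⨆ ν : ℝ, ⨆ _ : μ ≤ ν, T.eigenspace (ν : ℂ)
  set F : Submodule ℂ H := ⨆ ν : ℝ, ⨆ _ : ν < μ, T.eigenspace (ν : ℂ)
    with hF
  have hFE : F ≤ Eᗮ := by
    refine iSup_le fun ν => iSup_le fun hν v hv => ?_
    refine (Submodule.mem_orthogonal' _ _).2 fun w hw => ?_
    have hle : E ≤ (ℂ ∙ v)ᗮ := by
      refine iSup_le fun ξ => iSup_le fun hξ u hu => ?_
      rw [Submodule.mem_orthogonal_singleton_iff_inner_right]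
      exact hT.orthogonalFamily_eigenspaces
        (fun h => (hν.trans_le hξ).ne (Complex.ofReal_injective h)) ⟨v, hv⟩ ⟨u, hu⟩
    exact Submodule.mem_orthogonal_singleton_iff_inner_right.1 (hle hw)
  -- The part of `x` orthogonal to `F` is orthogonal to all eigenvectors, so it vanishes.
  have hxF : x ∈ F.topologicalClosure := by
    have hclosed : IsClosed (F.topologicalClosure : Set H) := F.isClosed_topologicalClosure
    have : CompleteSpace F.topologicalClosure := hclosed.completeSpace_coe
    obtain ⟨p, hp, q, hq, rfl⟩ := F.topologicalClosure.exists_add_mem_mem_orthogonal x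
    have hpE : p ∈ Eᗮ :=
      F.topologicalClosure_minimal hFE (Submodule.isClosed_orthogonal E) hp
    have hqE : q ∈ Eᗮ := by simpa using Submodule.sub_mem _ hx hpE
    have hqF : q ∈ Fᗮ := Submodule.orthogonal_le F.le_topologicalClosure hq
    have hq0 : q ∈ (⨆ ν : ℂ, T.eigenspace ν)ᗮ := by
      refine (Submodule.mem_orthogonal' _ _).2 fun w hw => ?_
      have hle : (⨆ ν : ℂ, T.eigenspace ν) ≤ (ℂ ∙ q)ᗮ := by
        refine iSup_le fun ν u hu => ?_
        rw [Submodule.mem_orthogonal_singleton_iff_inner_right]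
        rcases eq_or_ne u 0 with rfl | hu0
        · exact inner_zero_right _
        have hreal := hT.conj_eigenvalue_eq_self
          (Module.End.hasEigenvalue_of_hasEigenvector ⟨hu, hu0⟩)
        obtain ⟨r, rfl⟩ := Complex.conj_eq_iff_real.1 hreal
        rcases le_or_gt μ r with hr | hr
        · exact (Submodule.mem_orthogonal' _ _).1 hqE u
            (Submodule.mem_iSup_of_mem r (Submodule.mem_iSup_of_mem hr hu))
        · exact (Submodule.mem_orthogonal' _ _).1 hqF u
            (Submodule.mem_iSup_of_mem r (Submodule.mem_iSup_of_mem hr hu))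
      exact Submodule.mem_orthogonal_singleton_iff_inner_right.1 (hle hw)
    rw [show (⨆ ν : ℂ, T.eigenspace ν)ᗮ = ⊥ from
      ContinuousLinearMap.orthogonalComplement_iSup_eigenspaces_eq_bot
        (T := ContinuousLinearMap.mkOfIsCompactOperator hc) hc hT,
      Submodule.mem_bot] at hq0
    simpa [hq0] using hp
  have hcl : IsClosed {y : H | (inner ℂ y (T y)).re ≤ μ * ‖y‖ ^ 2} :=
    isClosed_le (Complex.continuous_re.comp (continuous_id.inner hc.continuous)) (by fun_prop)
  exact closure_minimal (fun y hy => re_inner_le_mul_norm_sq hT hy) hcl hxF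

/-- The set whose supremum defines the `n`-th eigenvalue is bounded by the operator norm, so that its
supremum is not a junk value. -/
theorem bddAbove_nthEigenvalue_set {T : Module.End ℂ H} (hT : Continuous T) (n : ℕ) :
    BddAbove {μ : ℝ | ((n + 1 : ℕ) : Cardinal) ≤
      Module.rank ℂ (⨆ ν : ℝ, ⨆ _ : μ ≤ ν, T.eigenspace (ν : ℂ) :
        Submodule ℂ H)} := by
  let T' : H →L[ℂ] H := ⟨T, hT⟩
  refine ⟨‖T'‖, fun μ hμ => ?_⟩
  by_contra! hlt
  have hbot : (⨆ ν : ℝ, ⨆ _ : μ ≤ ν, T.eigenspace (ν : ℂ) :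
      Submodule ℂ H) = ⊥ := by
    refine eq_bot_iff.2 (iSup_le fun ν => iSup_le fun hν v hv => ?_)
    have h1 : T v = (ν : ℂ) • v := Module.End.mem_eigenspace_iff.1 hv
    have h2 : ‖T v‖ ≤ ‖T'‖ * ‖v‖ := T'.le_opNorm v
    rw [h1, norm_smul, Complex.norm_real] at h2
    have h3 : ‖T'‖ < ‖ν‖ := hlt.trans_le (hν.trans (Real.le_norm_self ν))
    have h4 : ‖v‖ ≤ 0 := by
      by_contra! hv0
      exact absurd h2 (not_le.2 (mul_lt_mul_of_pos_right h3 hv0))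
    simpa using h4
  have h0 := hμ.out
  rw [hbot, rank_bot] at h0
  simp at h0

end Comparison

section Comparison

universe u

variable {H K : Type u} [NormedAddCommGroup H] [InnerProductSpace ℂ H] [CompleteSpace H]
  [AddCommGroup K] [Module ℂ K]

/-- The lower half of the min-max principle, with the test space given as a subspace `U` of a
vector space `K` mapped to `H`: if `μ ‖Φ u‖² ≤ ⟪Φ u, T (Φ u)⟫` with `Φ u ≠ 0` for all nonzero `u`
in `U`, which has dimension at least `n + 1`, then the `n`-th eigenvalue of `T` is at least `μ`. -/
theorem le_nthEigenvalue_of_forall {T : Module.End ℂ H}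
    (hc : IsCompactOperator T) (hT : T.IsSymmetric) {n : ℕ} {μ : ℝ}
    (Φ : K →ₗ[ℂ] H) (U : Submodule ℂ K) (hU : ((n + 1 : ℕ) : Cardinal) ≤ Module.rank ℂ U)
    (h0 : ∀ u ∈ U, Φ u = 0 → u = 0)
    (h : ∀ u ∈ U, μ * ‖Φ u‖ ^ 2 ≤ (inner ℂ (Φ u) (T (Φ u))).re) :
    μ ≤ nthEigenvalue T n := by
  refine le_of_forall_lt fun ξ hξ => ?_
  obtain ⟨ζ, h1, h2⟩ := exists_between hξ
  refine h1.trans_le (le_csSup (bddAbove_nthEigenvalue_set hc.continuous n) ?_)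
  rw [Set.mem_ofPred_eq]
  by_contra! hlt
  set E : Submodule ℂ H := ⨆ ν : ℝ, ⨆ _ : ζ ≤ ν, T.eigenspace (ν : ℂ)
    with hE
  have : FiniteDimensional ℂ E :=
    Module.rank_lt_aleph0_iff.1 (hlt.trans (Cardinal.natCast_lt_aleph0))
  -- A nonzero `u ∈ U` with `Φ u ⟂ E` would contradict the bound of the form on `Eᗮ`, so projecting
  -- `Φ u` to `E` is injective on `U`, although `U` has the larger dimension.
  have hinj : Function.Injective
      ((E.orthogonalProjectionOnto : H →ₗ[ℂ] E) ∘ₗ Φ ∘ₗ U.subtype) := by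
    rw [injective_iff_map_eq_zero]
    intro u hu
    have hu' : Φ u ∈ Eᗮ := by
      rw [← Submodule.orthogonalProjectionOnto_eq_zero_iff]
      exact hu
    have h3 := re_inner_le_of_mem_orthogonal hc hT hu'
    have h4 := h u u.2
    have h5 : Φ u = 0 := by
      by_contra hne
      have : 0 < ‖Φ u‖ ^ 2 := by positivity
      nlinarith
    exact Subtype.ext (h0 u u.2 h5)
  exact absurd (hU.trans (LinearMap.rank_le_of_injective _ hinj)) (not_le.2 hlt)

theorem nthEigenvalue_nonneg {T : Module.End ℂ H} (hc : IsCompactOperator T)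
    (hT : T.IsSymmetric) (hpos : ∀ x, 0 ≤ (inner ℂ x (T x)).re) (n : ℕ) :
    0 ≤ nthEigenvalue T n := by
  by_cases hn : ((n + 1 : ℕ) : Cardinal) ≤ Module.rank ℂ H
  · exact le_nthEigenvalue_of_forall hc hT LinearMap.id ⊤ (by rwa [rank_top])
      (fun u _ hu => hu) (fun u _ => by simpa using hpos u)
  -- In a space of dimension at most `n` the defining set is empty, and its supremum is `0`.
  · have hempty : {μ : ℝ | ((n + 1 : ℕ) : Cardinal) ≤
        Module.rank ℂ (⨆ ν : ℝ, ⨆ _ : μ ≤ ν, T.eigenspace (ν : ℂ) : Submodule ℂ H)} = ∅ :=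
      Set.eq_empty_of_forall_notMem fun μ hμ => hn (le_trans hμ.out (Submodule.rank_le _))
    rw [nthEigenvalue, hempty, Real.sSup_empty]

/-- Comparison of eigenvalues: if `Φ` bounds the form of `T₁` by that of `T₂` and multiplies
squared norms by at most `M`, then eigenvalues of `T₁` are at most `κ * M` times those of `T₂`. -/
theorem nthEigenvalue_le_of_forall {G : Type u} [NormedAddCommGroup G] [InnerProductSpace ℂ G]
    {T₁ : Module.End ℂ G} {T₂ : Module.End ℂ H} (hT₁ : T₁.IsSymmetric)
    (hc : IsCompactOperator T₂) (hT₂ : T₂.IsSymmetric)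
    (hpos : ∀ x, 0 ≤ (inner ℂ x (T₂ x)).re) (Φ : G →ₗ[ℂ] H) {κ M : ℝ} (hκ : 0 < κ) (hM : 0 < M)
    (hform : ∀ x, (inner ℂ x (T₁ x)).re ≤ κ * (inner ℂ (Φ x) (T₂ (Φ x))).re)
    (hnorm : ∀ x, ‖Φ x‖ ^ 2 ≤ M * ‖x‖ ^ 2) (n : ℕ) :
    nthEigenvalue T₁ n ≤ κ * M * nthEigenvalue T₂ n := by
  have h0 := nthEigenvalue_nonneg hc hT₂ hpos n
  refine Real.sSup_le (fun μ hμ => ?_) (by positivity)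
  rcases le_or_gt μ 0 with hμ0 | hμ0
  · exact hμ0.trans (by positivity)
  rw [← div_le_iff₀' (by positivity)]
  refine le_nthEigenvalue_of_forall hc hT₂ Φ _ hμ.out (fun u hu h => ?_) (fun u hu => ?_)
  · have h1 := (mul_norm_sq_le_re_inner hT₁ hu).trans (hform u)
    rw [h, inner_zero_left, Complex.zero_re, mul_zero] at h1
    by_contra hne
    have : 0 < μ * ‖u‖ ^ 2 := by positivity
    linarith
  · have h1 := (mul_norm_sq_le_re_inner hT₁ hu).trans (hform u)
    calc μ / (κ * M) * ‖Φ u‖ ^ 2 ≤ μ / (κ * M) * (M * ‖u‖ ^ 2) := by gcongr; exact hnorm u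
      _ = μ * ‖u‖ ^ 2 / κ := by field_simp
      _ ≤ _ := by rwa [div_le_iff₀' hκ]

end Comparison

/-! ### Compactness of convolution operators -/

section Compactness

theorem Lp_norm_sq_eq_integral {α : Type*} [MeasurableSpace α] {μ : Measure α} (f : Lp ℂ 2 μ) :
    ‖f‖ ^ 2 = ∫ x, ‖f x‖ ^ 2 ∂μ := by
  rw [← inner_self_eq_norm_sq (𝕜 := ℂ), L2.inner_def, ← integral_re (L2.integrable_inner f f)]
  exact integral_congr_ae (Filter.Eventually.of_forall fun x => inner_self_eq_norm_sq (𝕜 := ℂ) _)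

theorem sq_norm_integral_mul_le {α : Type*} [MeasurableSpace α] {μ : Measure α} {f g : α → ℂ}
    (hf : MemLp f 2 μ) (hg : MemLp g 2 μ) :
    ‖∫ x, f x * g x ∂μ‖ ^ 2 ≤ (∫ x, ‖f x‖ ^ 2 ∂μ) * ∫ x, ‖g x‖ ^ 2 ∂μ := by
  have h := integral_mul_norm_le_Lp_mul_Lq (μ := μ) (f := f) (g := g) Real.HolderConjugate.two_two
    (by simpa using hf) (by simpa using hg)
  have hf0 : 0 ≤ ∫ x, ‖f x‖ ^ 2 ∂μ := integral_nonneg fun x => sq_nonneg _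
  have hg0 : 0 ≤ ∫ x, ‖g x‖ ^ 2 ∂μ := integral_nonneg fun x => sq_nonneg _
  simp only [Real.rpow_two, ← Real.sqrt_eq_rpow] at h
  have h1 : ‖∫ x, f x * g x ∂μ‖ ≤ ∫ x, ‖f x‖ * ‖g x‖ ∂μ :=
    (norm_integral_le_integral_norm _).trans_eq (by simp only [norm_mul])
  calc ‖∫ x, f x * g x ∂μ‖ ^ 2
      ≤ (√(∫ x, ‖f x‖ ^ 2 ∂μ) * √(∫ x, ‖g x‖ ^ 2 ∂μ)) ^ 2 := by
        gcongr; exact h1.trans h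
    _ = _ := by rw [mul_pow, Real.sq_sqrt hf0, Real.sq_sqrt hg0]

/-- An integral operator with kernel bounded by `D` on a finite measure space has operator norm at
most `D` times the total mass. -/
theorem norm_le_of_ae_eq_integral {α : Type*} [MeasurableSpace α] {μ : Measure α}
    [IsFiniteMeasure μ] {f g : Lp ℂ 2 μ} {K : α → α → ℂ} {D : ℝ} (hD : 0 ≤ D)
    (hg : ∀ᵐ x ∂μ, g x = ∫ y, K x y * f y ∂μ) (hKm : ∀ x, AEStronglyMeasurable (K x) μ)
    (hK : ∀ᵐ x ∂μ, ∀ᵐ y ∂μ, ‖K x y‖ ≤ D) :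
    ‖g‖ ≤ D * μ.real Set.univ * ‖f‖ := by
  have hpt : ∀ᵐ x ∂μ, ‖g x‖ ^ 2 ≤ D ^ 2 * μ.real Set.univ * ‖f‖ ^ 2 := by
    filter_upwards [hg, hK] with x hx hx'
    have hKx : MemLp (K x) 2 μ := MemLp.of_bound (hKm x) D hx'
    rw [hx, Lp_norm_sq_eq_integral f]
    refine (sq_norm_integral_mul_le hKx (Lp.memLp f)).trans ?_
    have h0 : 0 ≤ ∫ y, ‖f y‖ ^ 2 ∂μ := integral_nonneg fun y => sq_nonneg ‖f y‖
    refine mul_le_mul_of_nonneg_right ?_ h0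
    · calc ∫ y, ‖K x y‖ ^ 2 ∂μ ≤ ∫ _, D ^ 2 ∂μ :=
            integral_mono_ae hKx.integrable_norm_pow' (integrable_const _)
              (hx'.mono fun y hy => by dsimp only; gcongr)
        _ = _ := by rw [integral_const, smul_eq_mul, mul_comm]
  have h2 : ‖g‖ ^ 2 ≤ (D * μ.real Set.univ * ‖f‖) ^ 2 := by
    rw [Lp_norm_sq_eq_integral g]
    calc ∫ x, ‖g x‖ ^ 2 ∂μ ≤ ∫ _, D ^ 2 * μ.real Set.univ * ‖f‖ ^ 2 ∂μ :=
          integral_mono_ae (Lp.memLp g).integrable_norm_pow' (integrable_const _) hpt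
      _ = _ := by rw [integral_const, smul_eq_mul]; ring
  exact le_of_sq_le_sq h2 (by positivity)

theorem memLp_of_continuous {a : ℝ} {u : ℝ → ℂ} (hu : Continuous u) :
    MemLp u 2 (volume.restrict (Set.Icc (-a) a)) := by
  obtain ⟨C, hC⟩ := isCompact_Icc.exists_bound_of_continuousOn (hu.continuousOn (s := Set.Icc (-a) a))
  exact MemLp.of_bound hu.aestronglyMeasurable C
    ((ae_restrict_mem measurableSet_Icc).mono fun x hx => hC x hx)

theorem isCompactOperator_rankOne {E F : Type*} [NormedAddCommGroup E] [NormedSpace ℂ E]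
    [NormedAddCommGroup F] [InnerProductSpace ℂ F] (u : E) (v : F) :
    IsCompactOperator (InnerProductSpace.rankOne ℂ u v) := by
  rw [InnerProductSpace.rankOne_def']
  exact (isCompactOperator_of_locallyCompactSpace_dom (innerSL ℂ v)).clm_comp
    (ContinuousLinearMap.toSpanSingleton ℂ u)

/-- A polynomial in `x - y` is a finite sum of products of a function of `y` and a power of `x`. -/
theorem polynomial_eval_sub (p : Polynomial ℝ) (x y : ℝ) :
    p.eval (x - y) =
      ∑ i ∈ Finset.range (p.natDegree + 1), (Polynomial.hasseDeriv i p).eval (-y) * x ^ i := by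
  rw [sub_eq_add_neg, ← Polynomial.taylor_eval, Polynomial.eval_eq_sum_range,
    Polynomial.natDegree_taylor]
  simp only [Polynomial.taylor_coeff]

theorem convOperator_coeFn {a C : ℝ} {k : ℝ → ℝ} (hk : Measurable k) (hb : ∀ t, |k t| ≤ C)
    (f : L2Interval a) :
    convOperator a k hk hb f =ᵐ[volume.restrict (Set.Icc (-a) a)] convIntegral a k f :=
  (convIntegral_memLp hk hb f).coeFn_toLp

/-- Convolution with a continuous kernel on a bounded interval is compact: a uniform polynomial
approximation `p` of the kernel gives the finite rank operator with kernel `p (x - y)`. The kernel may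
differ from a continuous function at `0`, which affects a null set only. -/
theorem isCompactOperator_convOperator {a C : ℝ} {k k' : ℝ → ℝ} (hk : Measurable k)
    (hb : ∀ t, |k t| ≤ C) (hk' : Continuous k') (heq : ∀ t, t ≠ 0 → k t = k' t) :
    IsCompactOperator (convOperator a k hk hb) := by
  set ρ : Measure ℝ := volume.restrict (Set.Icc (-a) a) with hρ
  have hC : 0 ≤ C := (abs_nonneg _).trans (hb 0)
  have hkm : ∀ x, AEStronglyMeasurable (fun y => (k (x - y) : ℂ)) ρ := fun x =>
    (Complex.measurable_ofReal.comp
      (hk.comp (measurable_const.sub measurable_id))).aestronglyMeasurable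
  have hbound : ∀ f, ‖convOperator a k hk hb f‖ ≤ C * ρ.real Set.univ * ‖f‖ := fun f =>
    norm_le_of_ae_eq_integral hC (convOperator_coeFn hk hb f) hkm
      (Filter.Eventually.of_forall fun x => Filter.Eventually.of_forall fun y => by
        simpa using hb (x - y))
  let T : L2Interval a →L[ℂ] L2Interval a := (convOperator a k hk hb).mkContinuous _ hbound
  change IsCompactOperator T
  refine isClosed_setOfPred_isCompactOperator.closure_subset (Metric.mem_closure_iff.2 ?_)
  intro ε hε
  set δ : ℝ := ε / (2 * (ρ.real Set.univ + 1)) with hδ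
  have hm : 0 ≤ ρ.real Set.univ := measureReal_nonneg
  have hδ0 : 0 < δ := by positivity
  obtain ⟨p, hp⟩ := exists_polynomial_near_of_continuousOn (-(2 * a)) (2 * a) k' hk'.continuousOn
    δ hδ0
  have hu : ∀ i : ℕ, MemLp (fun x : ℝ => (x : ℂ) ^ i) 2 ρ := fun i =>
    memLp_of_continuous (by fun_prop)
  have hv : ∀ i : ℕ, MemLp (fun y : ℝ => (((Polynomial.hasseDeriv i p).eval (-y) : ℝ) : ℂ)) 2 ρ :=
    fun i => memLp_of_continuous (by fun_prop)
  let S : L2Interval a →L[ℂ] L2Interval a := ∑ i ∈ Finset.range (p.natDegree + 1),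
    InnerProductSpace.rankOne ℂ ((hu i).toLp _) ((hv i).toLp _)
  have hS : IsCompactOperator S :=
    Submodule.sum_mem (compactOperator (RingHom.id ℂ) (L2Interval a) (L2Interval a))
      fun i _ => isCompactOperator_rankOne _ _
  refine ⟨S, hS, ?_⟩
  have hSf : ∀ f : L2Interval a, S f =ᵐ[ρ] fun x => ∫ y, ((p.eval (x - y) : ℝ) : ℂ) * f y ∂ρ := by
    intro f
    have h1 : S f = ∑ i ∈ Finset.range (p.natDegree + 1),
        (inner ℂ ((hv i).toLp _) f : ℂ) • (hu i).toLp _ := by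
      simp only [S, sum_apply, InnerProductSpace.rankOne_apply]
    have h2 : ∀ i, (inner ℂ ((hv i).toLp _) f : ℂ) =
        ∫ y, (((Polynomial.hasseDeriv i p).eval (-y) : ℝ) : ℂ) * f y ∂ρ := by
      intro i
      rw [L2.inner_def]
      refine integral_congr_ae ?_
      filter_upwards [(hv i).coeFn_toLp] with y hy
      rw [hy, RCLike.inner_apply, Complex.conj_ofReal, mul_comm]
    rw [h1]
    refine (Lp.coeFn_fun_finsetSum _ _).trans ?_
    have h3 : ∀ᵐ x ∂ρ, ∀ i : ℕ, ((inner ℂ ((hv i).toLp _) f : ℂ) • (hu i).toLp _ : L2Interval a) x =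
        (inner ℂ ((hv i).toLp _) f : ℂ) * (x : ℂ) ^ i := by
      refine ae_all_iff.2 fun i => ?_
      filter_upwards [Lp.coeFn_smul (inner ℂ ((hv i).toLp _) f : ℂ) ((hu i).toLp _),
        (hu i).coeFn_toLp] with x hx hx'
      rw [hx, Pi.smul_apply, hx', smul_eq_mul]
    filter_upwards [h3] with x hx
    simp only [hx]
    simp only [h2]
    simp only [polynomial_eval_sub, Complex.ofReal_sum, Complex.ofReal_mul, Complex.ofReal_pow,
      Finset.sum_mul]
    rw [integral_finsetSum]
    · refine Finset.sum_congr rfl fun i _ => ?_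
      rw [← integral_mul_const]
      exact integral_congr_ae (Filter.Eventually.of_forall fun y => by ring)
    · intro i _
      exact (((hv i).integrable_mul (Lp.memLp f)).mul_const ((x : ℂ) ^ i)).congr
        (Filter.Eventually.of_forall fun y => by simp only [Pi.mul_apply]; ring)
  have hpm : ∀ x : ℝ, Continuous fun y : ℝ => ((p.eval (x - y) : ℝ) : ℂ) := fun x => by fun_prop
  have hdiff : ‖T - S‖ ≤ δ * ρ.real Set.univ := by
    refine ContinuousLinearMap.opNorm_le_bound _ (by positivity) fun f => ?_
    refine norm_le_of_ae_eq_integral (K := fun x y => (k (x - y) : ℂ) - (p.eval (x - y) : ℝ))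
      hδ0.le ?_ (fun x => (hkm x).sub (hpm x).aestronglyMeasurable) ?_
    · filter_upwards [Lp.coeFn_sub (T f) (S f), convOperator_coeFn hk hb f, hSf f] with x h1 h2 h3
      have h4 : (T - S) f = T f - S f := rfl
      have h5 : T f x = convIntegral a k f x := h2
      have h6 : Integrable (fun y => ((p.eval (x - y) : ℝ) : ℂ) * f y) ρ :=
        (memLp_of_continuous (hpm x)).integrable_mul (Lp.memLp f)
      rw [h4, h1, Pi.sub_apply, h5, h3, convIntegral,
        ← integral_sub (convIntegral_integrable hk hb f x) h6]
      simp only [sub_mul]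
    · filter_upwards [ae_restrict_mem measurableSet_Icc] with x hx
      have hne : ∀ᵐ y ∂ρ, y ≠ x := ae_restrict_of_ae (Measure.ae_ne volume x)
      filter_upwards [ae_restrict_mem measurableSet_Icc, hne] with y hy hxy
      rw [heq _ (sub_ne_zero.2 hxy.symm), ← Complex.ofReal_sub, Complex.norm_real, norm_sub_rev]
      exact (hp (x - y) ⟨by linarith [hx.1, hy.2], by linarith [hx.2, hy.1]⟩).le
  rw [dist_eq_norm]
  refine hdiff.trans_lt ?_
  rw [hδ, div_mul_eq_mul_div, div_lt_iff₀ (by positivity)]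
  nlinarith

end Compactness

/-! ### Quadratic forms of convolution operators -/

section QuadraticForm

open scoped ComplexConjugate

/-- Fubini's theorem for a kernel of modulus one. -/
theorem integral_integral_exp_mul {α β : Type*} [MeasurableSpace α] [MeasurableSpace β]
    {μ : Measure α} {ν : Measure β} [SFinite μ] [SFinite ν] {φ : α → β → ℝ}
    (hφ : Measurable (Function.uncurry φ)) {u : α → ℂ} (hu : Integrable u μ) {v : β → ℂ}
    (hv : Integrable v ν) :
    ∫ x, (∫ s, Complex.exp ((φ x s : ℂ) * Complex.I) * v s ∂ν) * u x ∂μ =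
      ∫ s, (∫ x, Complex.exp ((φ x s : ℂ) * Complex.I) * u x ∂μ) * v s ∂ν := by
  have hint : Integrable (Function.uncurry fun x s =>
      Complex.exp ((φ x s : ℂ) * Complex.I) * (u x * v s)) (μ.prod ν) := by
    refine (hu.mul_prod hv).bdd_mul (c := 1) ?_ ?_
    · exact (Complex.measurable_exp.comp
        ((Complex.measurable_ofReal.comp hφ).mul_const _)).aestronglyMeasurable
    · exact Filter.Eventually.of_forall fun p => (Complex.norm_exp_ofReal_mul_I _).le
  calc _ = ∫ x, ∫ s, Complex.exp ((φ x s : ℂ) * Complex.I) * (u x * v s) ∂ν ∂μ := by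
        refine integral_congr_ae (Filter.Eventually.of_forall fun x => ?_)
        dsimp only
        rw [← integral_mul_const]
        exact integral_congr_ae (Filter.Eventually.of_forall fun s => by ring)
    _ = ∫ s, ∫ x, Complex.exp ((φ x s : ℂ) * Complex.I) * (u x * v s) ∂μ ∂ν :=
        integral_integral_swap hint
    _ = _ := by
        refine integral_congr_ae (Filter.Eventually.of_forall fun s => ?_)
        dsimp only
        rw [← integral_mul_const]
        exact integral_congr_ae (Filter.Eventually.of_forall fun x => by ring)

/-- The Fourier transform `∫_{-a}^{a} e^{-iωy} f(y) dy` of a function on `(-a, a)`, at the angular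
frequency `ω`. -/
noncomputable def windowFourier (a : ℝ) (f : ℝ → ℂ) (ω : ℝ) : ℂ :=
  ∫ y in Set.Icc (-a) a, Complex.exp (((-(ω * y) : ℝ) : ℂ) * Complex.I) * f y

theorem windowFourier_congr {a : ℝ} {f g : ℝ → ℂ}
    (h : f =ᵐ[volume.restrict (Set.Icc (-a) a)] g) (ω : ℝ) :
    windowFourier a f ω = windowFourier a g ω :=
  integral_congr_ae (h.mono fun y hy => by dsimp only; rw [hy])

theorem continuous_windowFourier {a : ℝ} {f : ℝ → ℂ}
    (hf : Integrable f (volume.restrict (Set.Icc (-a) a))) : Continuous (windowFourier a f) := by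
  refine continuous_of_dominated (bound := fun y => ‖f y‖) (fun ω => ?_) (fun ω => ?_) hf.norm ?_
  · exact (Continuous.aestronglyMeasurable (by fun_prop)).mul hf.aestronglyMeasurable
  · exact Filter.Eventually.of_forall fun y => by
      rw [norm_mul, Complex.norm_exp_ofReal_mul_I, one_mul]
  · exact Filter.Eventually.of_forall fun y => by fun_prop

theorem norm_windowFourier_le {a : ℝ} {f : ℝ → ℂ} (ω : ℝ) :
    ‖windowFourier a f ω‖ ≤ ∫ y in Set.Icc (-a) a, ‖f y‖ :=
  (norm_integral_le_integral_norm _).trans_eq (by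
    simp only [norm_mul, Complex.norm_exp_ofReal_mul_I, one_mul])

theorem Lp_integrable {a : ℝ} (f : L2Interval a) :
    Integrable (f : ℝ → ℂ) (volume.restrict (Set.Icc (-a) a)) :=
  (Lp.memLp f).integrable (by norm_num)

variable {a C w : ℝ} {k : ℝ → ℝ} {ι : Type*} [MeasurableSpace ι] {ν : Measure ι}
  [IsFiniteMeasure ν] {θ : ι → ℝ}

/-- If the kernel is a superposition of the exponentials `e^{iθ(s)t}`, then its sesquilinear form
is the `L²` product of the sampled Fourier transforms. -/
theorem inner_convOperator (hk : Measurable k) (hb : ∀ t, |k t| ≤ C) (hθ : Measurable θ)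
    (hkθ : ∀ t, t ≠ 0 → |t| ≤ 2 * a →
      (k t : ℂ) = w * ∫ s, Complex.exp (((θ s * t : ℝ) : ℂ) * Complex.I) ∂ν)
    (f g : L2Interval a) :
    inner ℂ g (convOperator a k hk hb f) =
      w * ∫ s, conj (windowFourier a g (θ s)) * windowFourier a f (θ s) ∂ν := by
  have hv : Integrable (fun s => windowFourier a f (θ s)) ν :=
    Integrable.of_bound ((continuous_windowFourier (Lp_integrable f)).measurable.comp
      hθ).aestronglyMeasurable _ (Filter.Eventually.of_forall fun s => norm_windowFourier_le _)
  have hT : ∀ x ∈ Set.Icc (-a) a, convIntegral a k f x =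
      w * ∫ s, Complex.exp (((θ s * x : ℝ) : ℂ) * Complex.I) * windowFourier a f (θ s) ∂ν := by
    intro x hx
    have hne : ∀ᵐ y ∂volume.restrict (Set.Icc (-a) a), y ≠ x :=
      ae_restrict_of_ae (Measure.ae_ne volume x)
    calc convIntegral a k f x = ∫ y in Set.Icc (-a) a,
          w * ((∫ s, Complex.exp (((θ s * (x - y) : ℝ) : ℂ) * Complex.I) * 1 ∂ν) * f y) := by
          refine integral_congr_ae ?_
          filter_upwards [ae_restrict_mem measurableSet_Icc, hne] with y hy hxy
          rw [hkθ _ (sub_ne_zero.2 hxy.symm)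
            (abs_le.2 ⟨by linarith [hx.1, hy.2], by linarith [hx.2, hy.1]⟩)]
          simp only [mul_one, mul_assoc]
      _ = w * ∫ s, (∫ y in Set.Icc (-a) a,
            Complex.exp (((θ s * (x - y) : ℝ) : ℂ) * Complex.I) * f y) * 1 ∂ν := by
          rw [integral_const_mul, integral_integral_exp_mul
            (φ := fun y s => θ s * (x - y)) _ (Lp_integrable f) (integrable_const 1)]
          exact (hθ.comp measurable_snd).mul (measurable_const.sub measurable_fst)
      _ = _ := by
          congr 1
          refine integral_congr_ae (Filter.Eventually.of_forall fun s => ?_)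
          dsimp only
          rw [mul_one, windowFourier, ← integral_const_mul]
          refine integral_congr_ae (Filter.Eventually.of_forall fun y => ?_)
          dsimp only
          rw [← mul_assoc, ← Complex.exp_add]
          push_cast
          ring_nf
  have hg : Integrable (fun x => conj (g x)) (volume.restrict (Set.Icc (-a) a)) :=
    (Complex.conjLIE.toContinuousLinearEquiv.toContinuousLinearMap).integrable_comp
      (Lp_integrable g)
  rw [L2.inner_def]
  calc _ = ∫ x in Set.Icc (-a) a, w * ((∫ s, Complex.exp (((θ s * x : ℝ) : ℂ) * Complex.I) *
          windowFourier a f (θ s) ∂ν) * conj (g x)) := by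
        refine integral_congr_ae ?_
        filter_upwards [ae_restrict_mem measurableSet_Icc, convOperator_coeFn hk hb f] with x hx h
        rw [h, hT x hx, RCLike.inner_apply, mul_assoc]
    _ = _ := by
        rw [integral_const_mul, integral_integral_exp_mul (φ := fun x s => θ s * x) _ hg hv]
        · congr 1
          refine integral_congr_ae (Filter.Eventually.of_forall fun s => ?_)
          dsimp only
          congr 1
          rw [windowFourier, ← integral_conj]
          refine integral_congr_ae (Filter.Eventually.of_forall fun x => ?_)
          dsimp only
          rw [map_mul, ← Complex.exp_conj, map_mul, Complex.conj_ofReal, Complex.conj_I]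
          push_cast
          ring_nf
        · exact (hθ.comp measurable_snd).mul measurable_fst

theorem isSymmetric_convOperator (hk : Measurable k) (hb : ∀ t, |k t| ≤ C) (hθ : Measurable θ)
    (hkθ : ∀ t, t ≠ 0 → |t| ≤ 2 * a →
      (k t : ℂ) = w * ∫ s, Complex.exp (((θ s * t : ℝ) : ℂ) * Complex.I) ∂ν) :
    (convOperator a k hk hb).IsSymmetric := fun f g => by
  rw [← inner_conj_symm, inner_convOperator hk hb hθ hkθ, inner_convOperator hk hb hθ hkθ,
    map_mul, Complex.conj_ofReal, ← integral_conj]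
  congr 1
  refine integral_congr_ae (Filter.Eventually.of_forall fun s => ?_)
  simp only [map_mul, Complex.conj_conj, mul_comm]

theorem re_inner_convOperator (hk : Measurable k) (hb : ∀ t, |k t| ≤ C) (hθ : Measurable θ)
    (hkθ : ∀ t, t ≠ 0 → |t| ≤ 2 * a →
      (k t : ℂ) = w * ∫ s, Complex.exp (((θ s * t : ℝ) : ℂ) * Complex.I) ∂ν)
    (f : L2Interval a) :
    (inner ℂ f (convOperator a k hk hb f)).re = w * ∫ s, ‖windowFourier a f (θ s)‖ ^ 2 ∂ν := by
  rw [inner_convOperator hk hb hθ hkθ]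
  simp only [Complex.conj_mul']
  rw [← Complex.ofReal_re (w * ∫ s, ‖windowFourier a f (θ s)‖ ^ 2 ∂ν)]
  push_cast
  rw [← integral_complex_ofReal]
  push_cast
  rfl

end QuadraticForm

/-! ### The cosine window and its Fourier transform -/

section Window

/-- The Fourier transform `∫_{-1/2}^{1/2} cos(πu) cos(2πxu) du` of the cosine window. -/
noncomputable def cosineTransform (x : ℝ) : ℝ :=
  ∫ u in (-(1 / 2) : ℝ)..1 / 2, Real.cos (Real.pi * u) * Real.cos (2 * Real.pi * x * u)

theorem continuous_cosineTransform : Continuous cosineTransform :=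
  intervalIntegral.continuous_parametric_intervalIntegral_of_continuous' (by fun_prop) _ _

/-- The transform of the cosine window is even, and decreasing on `[0, 1/2]`, where the angle
`2πxu` stays in `[-π/2, π/2]`. -/
theorem cosineTransform_le {x y : ℝ} (hxy : |x| ≤ y) (hy : y ≤ 1 / 2) :
    cosineTransform y ≤ cosineTransform x := by
  refine intervalIntegral.integral_mono_on (by norm_num)
    (Continuous.intervalIntegrable (by fun_prop) _ _)
    (Continuous.intervalIntegrable (by fun_prop) _ _) fun u hu => ?_
  have hπ := Real.pi_pos
  have hu' : |u| ≤ 1 / 2 := abs_le.2 ⟨by linarith [hu.1], hu.2⟩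
  have h0 : 0 ≤ y := (abs_nonneg x).trans hxy
  refine mul_le_mul_of_nonneg_left ?_
    (Real.cos_nonneg_of_neg_pi_div_two_le_of_le (by nlinarith [hu.1]) (by nlinarith [hu.2]))
  rw [← Real.cos_abs (2 * Real.pi * x * u), ← Real.cos_abs (2 * Real.pi * y * u)]
  refine Real.cos_le_cos_of_nonneg_of_le_pi (abs_nonneg _) ?_ ?_
  · rw [abs_mul, abs_mul _ y, abs_of_pos (by positivity : 0 < 2 * Real.pi), abs_of_nonneg h0]
    calc 2 * Real.pi * y * |u| ≤ 2 * Real.pi * (1 / 2) * (1 / 2) := by gcongr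
      _ ≤ Real.pi := by linarith
  · rw [abs_mul, abs_mul, abs_mul _ u, abs_mul _ y, abs_of_nonneg h0]
    gcongr

/-- This endpoint is excluded from `cosineTransform_eq`, whose right side is `0 / 0` there. -/
theorem cosineTransform_half : cosineTransform (1 / 2) = 1 / 2 := by
  have hπ := Real.pi_pos.ne'
  have h : ∀ u : ℝ, Real.cos (Real.pi * u) * Real.cos (2 * Real.pi * (1 / 2) * u) =
      1 / 2 + 1 / 2 * Real.cos (2 * Real.pi * u) := fun u => by
    rw [show 2 * Real.pi * (1 / 2) * u = Real.pi * u by ring,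
      show 2 * Real.pi * u = 2 * (Real.pi * u) by ring, Real.cos_two_mul]
    ring
  simp only [cosineTransform, h]
  rw [intervalIntegral.integral_add (by simp) (Continuous.intervalIntegrable (by fun_prop) _ _),
    intervalIntegral.integral_const_mul,
    intervalIntegral.integral_comp_mul_left (fun v => Real.cos v) (by positivity), integral_cos]
  rw [show 2 * Real.pi * (1 / 2) = Real.pi by ring,
    show 2 * Real.pi * -(1 / 2) = -Real.pi by ring, Real.sin_neg, Real.sin_pi]
  norm_num

theorem cosineTransform_eq {x : ℝ} (hx : |x| < 1 / 2) :
    cosineTransform x = Real.cos (Real.pi * x) / (2 * Real.pi * (1 / 4 - x ^ 2)) := by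
  obtain ⟨h1, h2⟩ := abs_lt.1 hx
  have hπ := Real.pi_pos
  have h : ∀ u : ℝ, Real.cos (Real.pi * u) * Real.cos (2 * Real.pi * x * u) =
      1 / 2 * Real.cos (Real.pi * (1 - 2 * x) * u) +
        1 / 2 * Real.cos (Real.pi * (1 + 2 * x) * u) := fun u => by
    rw [show Real.pi * (1 - 2 * x) * u = Real.pi * u - 2 * Real.pi * x * u by ring,
      show Real.pi * (1 + 2 * x) * u = Real.pi * u + 2 * Real.pi * x * u by ring,
      Real.cos_sub, Real.cos_add]
    ring
  have ha : 0 < 1 - 2 * x := by linarith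
  have hb : 0 < 1 + 2 * x := by linarith
  simp only [cosineTransform, h]
  rw [intervalIntegral.integral_add (Continuous.intervalIntegrable (by fun_prop) _ _)
      (Continuous.intervalIntegrable (by fun_prop) _ _),
    intervalIntegral.integral_const_mul, intervalIntegral.integral_const_mul,
    intervalIntegral.integral_comp_mul_left (fun v => Real.cos v) (by positivity),
    intervalIntegral.integral_comp_mul_left (fun v => Real.cos v) (by positivity),
    integral_cos, integral_cos]
  rw [show Real.pi * (1 - 2 * x) * (1 / 2) = Real.pi / 2 - Real.pi * x by ring,
    show Real.pi * (1 - 2 * x) * -(1 / 2) = -(Real.pi / 2 - Real.pi * x) by ring,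
    show Real.pi * (1 + 2 * x) * (1 / 2) = Real.pi * x + Real.pi / 2 by ring,
    show Real.pi * (1 + 2 * x) * -(1 / 2) = -(Real.pi * x + Real.pi / 2) by ring,
    Real.sin_neg, Real.sin_neg, Real.sin_add_pi_div_two, Real.sin_pi_div_two_sub,
    show (1 / 4 - x ^ 2 : ℝ) = (1 - 2 * x) * (1 + 2 * x) / 4 by ring, smul_eq_mul, smul_eq_mul]
  field_simp
  ring

theorem half_le_cosineTransform {x : ℝ} (hx : |x| ≤ 1 / 2) : 1 / 2 ≤ cosineTransform x :=
  cosineTransform_half.symm.trans_le (cosineTransform_le hx le_rfl)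

theorem cosineTransform_le_two_div_pi {x : ℝ} (h0 : 0 ≤ x) (hx : x ≤ 1 / 2) :
    cosineTransform x ≤ 2 / Real.pi := by
  refine (cosineTransform_le (x := 0) (by simpa using h0) hx).trans_eq ?_
  rw [cosineTransform_eq (by norm_num), mul_zero, Real.cos_zero]
  field_simp
  norm_num

theorem comparisonConst_eq {W : ℝ} (h0 : 0 < W) (hW : W < 1 / 2) :
    comparisonConst W = 1 / (2 * cosineTransform W ^ 2) := by
  have hπ := Real.pi_pos
  have hcos : 0 < Real.cos (Real.pi * W) :=
    Real.cos_pos_of_mem_Ioo ⟨by nlinarith, by nlinarith⟩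
  have hW2 : 0 < 1 / 4 - W ^ 2 := by nlinarith
  rw [cosineTransform_eq (by rwa [abs_of_pos h0]), comparisonConst]
  generalize 1 / 4 - W ^ 2 = z at hW2
  field_simp

/-- The sine part of the exponential is odd, so it does not contribute. -/
theorem integral_exp_mul_cos (x : ℝ) :
    ∫ u in (-(1 / 2) : ℝ)..1 / 2, Complex.exp (((-(2 * Real.pi * u * x) : ℝ) : ℂ) * Complex.I) *
      (Real.cos (Real.pi * u) : ℂ) = cosineTransform x := by
  set J := ∫ u in (-(1 / 2) : ℝ)..1 / 2, Complex.exp (((-(2 * Real.pi * u * x) : ℝ) : ℂ) *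
    Complex.I) * (Real.cos (Real.pi * u) : ℂ) with hJ
  have h1 : J = ∫ u in (-(1 / 2) : ℝ)..1 / 2, Complex.exp (((2 * Real.pi * u * x : ℝ) : ℂ) *
      Complex.I) * (Real.cos (Real.pi * u) : ℂ) := by
    rw [hJ, ← neg_neg (1 / 2 : ℝ), ← intervalIntegral.integral_comp_neg, neg_neg]
    refine intervalIntegral.integral_congr fun u _ => ?_
    simp only [mul_neg, neg_mul, neg_neg, Real.cos_neg]
  have h2 : J + J = 2 * cosineTransform x := by
    nth_rewrite 2 [h1]
    rw [hJ, ← intervalIntegral.integral_add (Continuous.intervalIntegrable (by fun_prop) _ _)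
      (Continuous.intervalIntegrable (by fun_prop) _ _), cosineTransform,
      ← intervalIntegral.integral_ofReal, ← intervalIntegral.integral_const_mul]
    refine intervalIntegral.integral_congr fun u _ => ?_
    rw [Complex.ofReal_mul (Real.cos (Real.pi * u)), Complex.ofReal_cos (2 * Real.pi * x * u),
      mul_left_comm, Complex.two_cos]
    push_cast
    ring_nf
  linear_combination h2 / 2

end Window

/-! ### Samples of a Fourier transform and their averages -/

section Sampling

variable {W : ℝ} {f g : ℝ → ℂ}

/-- A frequency sample of `f = ψ g`, where `ψ` is the transform of the cosine window, is the
average of the transform of `g` against this window. -/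
theorem windowFourier_eq_integral (hg : Integrable g (volume.restrict (Set.Icc (-W) W)))
    (hfg : f =ᵐ[volume.restrict (Set.Icc (-W) W)] fun x => (cosineTransform x : ℂ) * g x)
    (s : ℝ) :
    windowFourier W f (2 * Real.pi * s) = ∫ u in Set.Ioc (-(1 / 2) : ℝ) (1 / 2),
      windowFourier W g (2 * Real.pi * (s + u)) * (Real.cos (Real.pi * u) : ℂ) := by
  have hv : Integrable (fun u : ℝ => (Real.cos (Real.pi * u) : ℂ))
      (volume.restrict (Set.Ioc (-(1 / 2) : ℝ) (1 / 2))) :=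
    (Continuous.integrableOn_Icc (by fun_prop)).mono_set Set.Ioc_subset_Icc_self
  have h := integral_integral_exp_mul (φ := fun x u => -(2 * Real.pi * (s + u) * x))
    (by fun_prop) hg hv
  rw [show (∫ u in Set.Ioc (-(1 / 2) : ℝ) (1 / 2),
    windowFourier W g (2 * Real.pi * (s + u)) * (Real.cos (Real.pi * u) : ℂ)) = _ from h.symm,
    windowFourier]
  refine integral_congr_ae ?_
  filter_upwards [hfg] with x hx
  rw [hx, ← integral_exp_mul_cos, intervalIntegral.integral_of_le (by norm_num), ← mul_assoc,
    ← integral_const_mul]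
  congr 1
  refine integral_congr_ae (Filter.Eventually.of_forall fun u => ?_)
  dsimp only
  rw [← mul_assoc, ← Complex.exp_add]
  push_cast
  ring_nf

theorem sq_norm_windowFourier_le (hg : Integrable g (volume.restrict (Set.Icc (-W) W)))
    (hfg : f =ᵐ[volume.restrict (Set.Icc (-W) W)] fun x => (cosineTransform x : ℂ) * g x)
    (s : ℝ) :
    ‖windowFourier W f (2 * Real.pi * s)‖ ^ 2 ≤
      1 / 2 * ∫ r in (s - 1 / 2)..(s + 1 / 2), ‖windowFourier W g (2 * Real.pi * r)‖ ^ 2 := by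
  have hG := continuous_windowFourier hg
  have hL2 : ∀ {F : ℝ → ℂ}, Continuous F →
      MemLp F 2 (volume.restrict (Set.Ioc (-(1 / 2) : ℝ) (1 / 2))) := fun hF =>
    (memLp_of_continuous (a := 1 / 2) hF).mono_measure
      (Measure.restrict_mono Set.Ioc_subset_Icc_self le_rfl)
  rw [windowFourier_eq_integral hg hfg]
  refine (sq_norm_integral_mul_le (hL2 (by fun_prop)) (hL2 (by fun_prop))).trans_eq ?_
  have h1 : ∫ u in Set.Ioc (-(1 / 2) : ℝ) (1 / 2), ‖(Real.cos (Real.pi * u) : ℂ)‖ ^ 2 = 1 / 2 := by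
    rw [← intervalIntegral.integral_of_le (by norm_num)]
    refine Eq.trans ?_ cosineTransform_half
    refine intervalIntegral.integral_congr fun u _ => ?_
    simp only [Complex.norm_real, Real.norm_eq_abs, sq_abs]
    rw [show 2 * Real.pi * (1 / 2) * u = Real.pi * u by ring, sq]
  rw [h1, mul_comm, ← intervalIntegral.integral_of_le (by norm_num),
    intervalIntegral.integral_comp_add_left
      (fun r => ‖windowFourier W g (2 * Real.pi * r)‖ ^ 2), sub_eq_add_neg]

/-- The unit intervals around the `N` frequencies `j - (N - 1) / 2` tile `(-N / 2, N / 2)`. -/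
theorem sum_sq_norm_windowFourier_le (hg : Integrable g (volume.restrict (Set.Icc (-W) W)))
    (hfg : f =ᵐ[volume.restrict (Set.Icc (-W) W)] fun x => (cosineTransform x : ℂ) * g x)
    (N : ℕ) :
    ∑ j : Fin N, ‖windowFourier W f (2 * Real.pi * (j - (N - 1) / 2))‖ ^ 2 ≤
      1 / 2 * ∫ r in (-(N / 2) : ℝ)..N / 2, ‖windowFourier W g (2 * Real.pi * r)‖ ^ 2 := by
  have hG := continuous_windowFourier hg
  have hsum := intervalIntegral.sum_integral_adjacent_intervals (μ := volume) (n := N)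
    (f := fun r => ‖windowFourier W g (2 * Real.pi * r)‖ ^ 2) (a := fun j => (j : ℝ) - N / 2)
    fun j _ => Continuous.intervalIntegrable (by fun_prop) _ _
  rw [Fin.sum_univ_eq_sum_range
    (fun j : ℕ => ‖windowFourier W f (2 * Real.pi * (j - (N - 1) / 2))‖ ^ 2)]
  rw [show ((0 : ℕ) : ℝ) - N / 2 = -(N / 2) by simp,
    show (N : ℝ) - N / 2 = N / 2 by ring] at hsum
  rw [← hsum, Finset.mul_sum]
  refine Finset.sum_le_sum fun j _ => (sq_norm_windowFourier_le hg hfg _).trans_eq ?_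
  congr 2
  · ring
  · push_cast; ring

end Sampling

/-! ### Spectral representation of the two kernels -/

section Kernels

/-- The sinc kernel for `c = π N W`, with frequencies scaled so that they run over
`(-N / 2, N / 2)`. -/
theorem sincKernel_eq_integral {W : ℝ} (hW : 0 < W) (N : ℕ) {t : ℝ} (ht : t ≠ 0) :
    (sincKernel (Real.pi * N * W) t : ℂ) = W * ∫ s in Set.Ioc (-(N / 2) : ℝ) (N / 2),
      Complex.exp (((W * (2 * Real.pi * s) * t : ℝ) : ℂ) * Complex.I) := by
  have hπ := Real.pi_pos.ne'
  have hc : ((2 * Real.pi * W * t : ℝ) : ℂ) * Complex.I ≠ 0 := by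
    simp [hπ, hW.ne', ht]
  rw [← intervalIntegral.integral_of_le (by linarith [(Nat.cast_nonneg N : (0 : ℝ) ≤ N)])]
  have h : ∀ s : ℝ, Complex.exp (((W * (2 * Real.pi * s) * t : ℝ) : ℂ) * Complex.I) =
      Complex.exp (((2 * Real.pi * W * t : ℝ) : ℂ) * Complex.I * s) := fun s => by
    push_cast; ring_nf
  simp only [h]
  rw [integral_exp_mul_complex hc, sincKernel]
  have hsin := Complex.two_sin (Real.pi * N * W * t : ℂ)
  rw [show ((2 * Real.pi * W * t : ℝ) : ℂ) * Complex.I * ((N / 2 : ℝ) : ℂ) =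
      (Real.pi * N * W * t : ℂ) * Complex.I by push_cast; ring,
    show ((2 * Real.pi * W * t : ℝ) : ℂ) * Complex.I * ((-(N / 2) : ℝ) : ℂ) =
      -(Real.pi * N * W * t : ℂ) * Complex.I by push_cast; ring]
  have hdiff : Complex.exp ((Real.pi * N * W * t : ℂ) * Complex.I) -
      Complex.exp (-(Real.pi * N * W * t : ℂ) * Complex.I) =
        2 * Complex.sin (Real.pi * N * W * t : ℂ) * Complex.I := by
    rw [hsin]
    linear_combination (Complex.exp ((Real.pi * N * W * t : ℂ) * Complex.I) -
      Complex.exp (-(Real.pi * N * W * t : ℂ) * Complex.I)) * Complex.I_mul_I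
  rw [hdiff]
  have h1 : (Real.pi : ℂ) ≠ 0 := Complex.ofReal_ne_zero.2 hπ
  have h2 : (W : ℂ) ≠ 0 := Complex.ofReal_ne_zero.2 hW.ne'
  have h3 : (t : ℂ) ≠ 0 := Complex.ofReal_ne_zero.2 ht
  have hI := Complex.I_ne_zero
  push_cast
  field_simp

theorem dirichletKernel_eq_sum (N : ℕ) {t : ℝ} (ht : t ≠ 0) (ht1 : |t| < 1) :
    (dirichletKernel N t : ℂ) = ∑ j : Fin N,
      Complex.exp (((2 * Real.pi * (j - (N - 1) / 2) * t : ℝ) : ℂ) * Complex.I) := by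
  obtain ⟨h1, h2⟩ := abs_lt.1 ht1
  have hπ := Real.pi_pos
  have hs : Real.sin (Real.pi * t) ≠ 0 := by
    rcases lt_or_gt_of_ne ht with h | h
    · exact (Real.sin_neg_of_neg_of_neg_pi_lt (by nlinarith) (by nlinarith)).ne
    · exact (Real.sin_pos_of_pos_of_lt_pi (by positivity) (by nlinarith)).ne'
  have hsC : Complex.sin (Real.pi * t : ℂ) ≠ 0 := by
    have := Complex.ofReal_ne_zero.2 hs
    push_cast at this
    exact this
  -- Multiplied by `sin (π t)`, the geometric sum telescopes.
  have key : (∑ j : Fin N,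
      Complex.exp (((2 * Real.pi * (j - (N - 1) / 2) * t : ℝ) : ℂ) * Complex.I)) *
        Complex.sin (Real.pi * t : ℂ) = Complex.sin (N * Real.pi * t : ℂ) := by
    have hstep : ∀ j : ℕ,
        Complex.exp (((2 * Real.pi * (j - (N - 1) / 2) * t : ℝ) : ℂ) * Complex.I) *
          Complex.sin (Real.pi * t : ℂ) =
        (-Complex.I / 2) * Complex.exp (2 * Real.pi * ((j + 1 : ℕ) - N / 2) * t * Complex.I) -
        (-Complex.I / 2) * Complex.exp (2 * Real.pi * (j - N / 2) * t * Complex.I) := by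
      intro j
      rw [Complex.sin,
        show (2 * Real.pi * ((j + 1 : ℕ) - N / 2) * t * Complex.I : ℂ) =
          ((2 * Real.pi * (j - (N - 1) / 2) * t : ℝ) : ℂ) * Complex.I + Real.pi * t * Complex.I by
            push_cast; ring,
        show (2 * Real.pi * (j - N / 2) * t * Complex.I : ℂ) =
          ((2 * Real.pi * (j - (N - 1) / 2) * t : ℝ) : ℂ) * Complex.I +
            -(Real.pi * t) * Complex.I by push_cast; ring,
        Complex.exp_add, Complex.exp_add]
      ring
    rw [Fin.sum_univ_eq_sum_range (fun j : ℕ =>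
      Complex.exp (((2 * Real.pi * (j - (N - 1) / 2) * t : ℝ) : ℂ) * Complex.I)),
      Finset.sum_mul, Finset.sum_congr rfl fun j _ => hstep j,
      Finset.sum_range_sub (fun j : ℕ => (-Complex.I / 2) *
        Complex.exp (2 * Real.pi * (j - N / 2) * t * Complex.I)), Complex.sin,
      show (2 * Real.pi * (N - N / 2) * t * Complex.I : ℂ) = N * Real.pi * t * Complex.I by ring,
      show (2 * Real.pi * ((0 : ℕ) - N / 2) * t * Complex.I : ℂ) =
        -(N * Real.pi * t) * Complex.I by push_cast; ring]
    ring
  rw [dirichletKernel]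
  push_cast at key ⊢
  rw [div_eq_iff hsC, key]

theorem isCompactOperator_sincOperator {c : ℝ} (hc : c ≠ 0) :
    IsCompactOperator (sincOperator c) := by
  refine isCompactOperator_convOperator (k' := fun t => c / Real.pi * Real.sinc (c * t)) _ _
    (by fun_prop) fun t ht => ?_
  rw [sincKernel, Real.sinc_of_ne_zero (mul_ne_zero hc ht)]
  field_simp

end Kernels

/-! ### Division by the window transform -/

section Rescale

/-- The scaling `u ↦ W u` carries Lebesgue measure on `(-1, 1)` to `1 / W` times that on
`(-W, W)`. -/
theorem map_mul_restrict_Icc {W : ℝ} (hW : 0 < W) :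
    (volume.restrict (Set.Icc (-1) 1)).map (W * ·) =
      ENNReal.ofReal W⁻¹ • volume.restrict (Set.Icc (-W) W) := by
  have hpre : (W * ·) ⁻¹' Set.Icc (-W) W = Set.Icc (-1 : ℝ) 1 := by
    ext u
    simp only [Set.mem_preimage, Set.mem_Icc]
    constructor <;> rintro ⟨h1, h2⟩ <;> constructor <;> nlinarith
  rw [← hpre, ← Measure.restrict_map (measurable_const_mul W) measurableSet_Icc,
    Real.map_volume_mul_left hW.ne', Measure.restrict_smul, abs_of_pos (inv_pos.2 hW)]

theorem ae_comp_mul {W : ℝ} (hW : 0 < W) {p : ℝ → Prop}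
    (h : ∀ᵐ x ∂volume.restrict (Set.Icc (-W) W), p x) :
    ∀ᵐ u ∂volume.restrict (Set.Icc (-1 : ℝ) 1), p (W * u) := by
  refine ae_of_ae_map (measurable_const_mul W).aemeasurable ?_
  rw [map_mul_restrict_Icc hW]
  exact Measure.ae_smul_measure h _

theorem integral_comp_mul {E : Type*} [NormedAddCommGroup E] [NormedSpace ℝ E] {W : ℝ}
    (hW : 0 < W) (F : ℝ → E) :
    ∫ u in Set.Icc (-1 : ℝ) 1, F (W * u) = W⁻¹ • ∫ x in Set.Icc (-W) W, F x := by
  rw [← (measurableEmbedding_mulLeft₀ hW.ne').integral_map, map_mul_restrict_Icc hW,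
    integral_smul_measure, ENNReal.toReal_ofReal (inv_pos.2 hW).le]

variable {W : ℝ}

theorem norm_div_cosineTransform_le (hW : W < 1 / 2) (z : ℂ) {x : ℝ}
    (hx : x ∈ Set.Icc (-W) W) :
    ‖z / cosineTransform x‖ ≤ (cosineTransform W)⁻¹ * ‖z‖ := by
  have hx' : |x| ≤ W := abs_le.2 hx
  have hψW : 1 / 2 ≤ cosineTransform W :=
    half_le_cosineTransform (by rw [abs_of_nonneg ((abs_nonneg x).trans hx')]; exact hW.le)
  have hψ := cosineTransform_le hx' hW.le
  rw [norm_div, Complex.norm_real, Real.norm_eq_abs, abs_of_pos (by linarith), div_eq_inv_mul]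
  gcongr

theorem memLp_div_cosineTransform (hW : W < 1 / 2) (f : L2Interval W) :
    MemLp (fun x => f x / cosineTransform x) 2 (volume.restrict (Set.Icc (-W) W)) := by
  refine (Lp.memLp f).of_le_mul (c := (cosineTransform W)⁻¹) ?_ ?_
  · exact ((Lp.aestronglyMeasurable f).aemeasurable.div
      (Complex.measurable_ofReal.comp
        continuous_cosineTransform.measurable).aemeasurable).aestronglyMeasurable
  · filter_upwards [ae_restrict_mem measurableSet_Icc] with x hx
    exact norm_div_cosineTransform_le hW _ hx

theorem memLp_rescale (h0 : 0 < W) (hW : W < 1 / 2) (f : L2Interval W) :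
    MemLp (fun u => f (W * u) / cosineTransform (W * u)) 2
      (volume.restrict (Set.Icc (-1 : ℝ) 1)) := by
  refine ((measurableEmbedding_mulLeft₀ h0.ne').memLp_map_measure_iff
    (g := fun x => f x / (cosineTransform x : ℂ))).1 ?_
  rw [map_mul_restrict_Icc h0]
  exact (memLp_div_cosineTransform hW f).smul_measure ENNReal.ofReal_ne_top

/-- The map `L²(-W, W) → L²(-1, 1)` that divides by the transform of the cosine window and rescales
the interval. -/
noncomputable def rescaleDiv (h0 : 0 < W) (hW : W < 1 / 2) : L2Interval W →ₗ[ℂ] L2Interval 1 where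
  toFun f := (memLp_rescale h0 hW f).toLp _
  map_add' f g := by
    rw [← MemLp.toLp_add, MemLp.toLp_eq_toLp_iff]
    filter_upwards [ae_comp_mul h0 (Lp.coeFn_add f g)] with u hu
    rw [hu, Pi.add_apply, Pi.add_apply, add_div]
  map_smul' r f := by
    rw [RingHom.id_apply, ← MemLp.toLp_const_smul, MemLp.toLp_eq_toLp_iff]
    filter_upwards [ae_comp_mul h0 (Lp.coeFn_smul r f)] with u hu
    rw [hu, Pi.smul_apply, Pi.smul_apply, smul_eq_mul, smul_eq_mul, mul_div_assoc]

theorem rescaleDiv_coeFn (h0 : 0 < W) (hW : W < 1 / 2) (f : L2Interval W) :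
    rescaleDiv h0 hW f =ᵐ[volume.restrict (Set.Icc (-1) 1)]
      fun u => f (W * u) / cosineTransform (W * u) :=
  (memLp_rescale h0 hW f).coeFn_toLp

theorem sq_norm_rescaleDiv_le (h0 : 0 < W) (hW : W < 1 / 2) (f : L2Interval W) :
    ‖rescaleDiv h0 hW f‖ ^ 2 ≤ 1 / (W * cosineTransform W ^ 2) * ‖f‖ ^ 2 := by
  rw [Lp_norm_sq_eq_integral, Lp_norm_sq_eq_integral]
  calc _ = ∫ u in Set.Icc (-1 : ℝ) 1, ‖f (W * u) / cosineTransform (W * u)‖ ^ 2 :=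
        integral_congr_ae ((rescaleDiv_coeFn h0 hW f).mono fun u hu => by dsimp only; rw [hu])
    _ = W⁻¹ * ∫ x in Set.Icc (-W) W, ‖f x / cosineTransform x‖ ^ 2 :=
        integral_comp_mul h0 fun x => ‖f x / (cosineTransform x : ℂ)‖ ^ 2
    _ ≤ W⁻¹ * ∫ x in Set.Icc (-W) W, (cosineTransform W)⁻¹ ^ 2 * ‖f x‖ ^ 2 := by
        refine mul_le_mul_of_nonneg_left ?_ (inv_pos.2 h0).le
        refine integral_mono_ae (memLp_div_cosineTransform hW f).integrable_norm_pow'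
          ((Lp.memLp f).integrable_norm_pow'.const_mul _) ?_
        filter_upwards [ae_restrict_mem measurableSet_Icc] with x hx
        calc _ ≤ ((cosineTransform W)⁻¹ * ‖f x‖) ^ 2 := by
              gcongr; exact norm_div_cosineTransform_le hW _ hx
          _ = _ := mul_pow _ _ _
    _ = _ := by
        rw [integral_const_mul]
        field_simp

theorem windowFourier_rescaleDiv (h0 : 0 < W) (hW : W < 1 / 2) (f : L2Interval W) (ω : ℝ) :
    windowFourier 1 (rescaleDiv h0 hW f) (W * ω) =
      W⁻¹ * windowFourier W (fun x => f x / cosineTransform x) ω := by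
  rw [windowFourier_congr (rescaleDiv_coeFn h0 hW f), windowFourier, windowFourier]
  have h := integral_comp_mul h0 fun x => Complex.exp (((-(ω * x) : ℝ) : ℂ) * Complex.I) *
    (f x / (cosineTransform x : ℂ))
  rw [Complex.real_smul] at h
  rw [← h]
  refine integral_congr_ae (Filter.Eventually.of_forall fun u => ?_)
  dsimp only
  rw [show -(W * ω * u) = -(ω * (W * u)) by ring]

end Rescale

/-! ### Comparison of the sinc and Dirichlet forms -/

section Forms

variable {W : ℝ}

theorem re_inner_sincOperator (h0 : 0 < W) (N : ℕ) (g : L2Interval 1) :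
    (inner ℂ g (sincOperator (Real.pi * N * W) g)).re =
      W * ∫ s in Set.Ioc (-(N / 2) : ℝ) (N / 2),
        ‖windowFourier 1 g (W * (2 * Real.pi * s))‖ ^ 2 :=
  re_inner_convOperator _ _ (by fun_prop) (fun _ ht _ => sincKernel_eq_integral h0 N ht) g

theorem isSymmetric_sincOperator (h0 : 0 < W) (N : ℕ) :
    (sincOperator (Real.pi * N * W)).IsSymmetric :=
  isSymmetric_convOperator _ _ (θ := fun s => W * (2 * Real.pi * s)) (by fun_prop)
    fun _ ht _ => sincKernel_eq_integral h0 N ht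

theorem dirichletKernel_eq_integral (hW : W < 1 / 2) (N : ℕ) {t : ℝ} (ht : t ≠ 0)
    (htW : |t| ≤ 2 * W) :
    (dirichletKernel N t : ℂ) = (1 : ℝ) * ∫ j : Fin N,
      Complex.exp (((2 * Real.pi * (j - (N - 1) / 2) * t : ℝ) : ℂ) * Complex.I) ∂Measure.count := by
  rw [dirichletKernel_eq_sum N ht (by linarith), integral_count, Complex.ofReal_one, one_mul]

theorem isSymmetric_dpswfOperator (hW : W < 1 / 2) (N : ℕ) :
    (dpswfOperator N W).IsSymmetric :=
  isSymmetric_convOperator _ _ (θ := fun j : Fin N => 2 * Real.pi * (j - (N - 1) / 2))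
    (measurable_of_finite _) fun _ ht htW => dirichletKernel_eq_integral hW N ht htW

theorem re_inner_dpswfOperator (hW : W < 1 / 2) (N : ℕ) (f : L2Interval W) :
    (inner ℂ f (dpswfOperator N W f)).re =
      ∑ j : Fin N, ‖windowFourier W f (2 * Real.pi * (j - (N - 1) / 2))‖ ^ 2 := by
  have h := re_inner_convOperator (w := 1) (dirichletKernel_measurable N) (dirichletKernel_abs_le N)
    (θ := fun j : Fin N => 2 * Real.pi * (j - (N - 1) / 2)) (measurable_of_finite _)
    (fun _ ht htW => dirichletKernel_eq_integral hW N ht htW) f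
  rwa [integral_count, one_mul] at h

theorem re_inner_dpswfOperator_le (h0 : 0 < W) (hW : W < 1 / 2) (N : ℕ) (f : L2Interval W) :
    (inner ℂ f (dpswfOperator N W f)).re ≤ W / 2 *
      (inner ℂ (rescaleDiv h0 hW f)
        (sincOperator (Real.pi * N * W) (rescaleDiv h0 hW f))).re := by
  have hg := (memLp_div_cosineTransform hW f).integrable (by norm_num)
  have hfg : f =ᵐ[volume.restrict (Set.Icc (-W) W)]
      fun x => (cosineTransform x : ℂ) * (f x / cosineTransform x) := by
    filter_upwards [ae_restrict_mem measurableSet_Icc] with x hx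
    have hψ := half_le_cosineTransform ((abs_le.2 hx).trans hW.le)
    rw [mul_div_cancel₀]
    exact Complex.ofReal_ne_zero.2 (by linarith)
  rw [re_inner_dpswfOperator hW, re_inner_sincOperator h0]
  refine (sum_sq_norm_windowFourier_le hg hfg N).trans_eq ?_
  rw [intervalIntegral.integral_of_le (by linarith [(Nat.cast_nonneg N : (0 : ℝ) ≤ N)])]
  simp only [windowFourier_rescaleDiv, norm_mul, mul_pow]
  rw [integral_const_mul, Complex.norm_real, norm_inv, Real.norm_eq_abs, abs_of_pos h0]
  field_simp

end Forms

theorem theorem2 (N : ℕ) (hN : 1 ≤ N) (W : ℝ) (hW0 : 0 < W) (hW : W < 1 / 2) :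
    (∀ n : ℕ, n < N →
      dpswfEigenvalue N W n ≤ comparisonConst W * sincEigenvalue (Real.pi * N * W) n) ∧
    Real.pi ^ 2 / 8 ≤ comparisonConst W ∧ comparisonConst W ≤ 2 := by
  have hψ : 1 / 2 ≤ cosineTransform W :=
    half_le_cosineTransform (by rw [abs_of_pos hW0]; exact hW.le)
  have hψ' := cosineTransform_le_two_div_pi hW0.le hW.le
  have hπ := Real.pi_pos
  have hN' : (0 : ℝ) < N := by exact_mod_cast hN
  refine ⟨fun n _ => ?_, ?_, ?_⟩
  · have h := nthEigenvalue_le_of_forall (isSymmetric_dpswfOperator hW N)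
      (isCompactOperator_sincOperator (c := Real.pi * N * W) (by positivity))
      (isSymmetric_sincOperator hW0 N)
      (fun g => by
        rw [re_inner_sincOperator hW0]
        exact mul_nonneg hW0.le (integral_nonneg fun s => by positivity))
      (rescaleDiv hW0 hW) (by positivity) (by positivity)
      (re_inner_dpswfOperator_le hW0 hW N) (sq_norm_rescaleDiv_le hW0 hW) n
    refine h.trans_eq ?_
    rw [comparisonConst_eq hW0 hW, sincEigenvalue]
    congr 1
    field_simp
  · rw [comparisonConst_eq hW0 hW, div_le_div_iff₀ (by norm_num) (by positivity)]
    calc Real.pi ^ 2 * (2 * cosineTransform W ^ 2)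
        ≤ Real.pi ^ 2 * (2 * (2 / Real.pi) ^ 2) := by gcongr
      _ = 1 * 8 := by field_simp; norm_num
  · rw [comparisonConst_eq hW0 hW, div_le_iff₀ (by positivity)]
    nlinarith
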